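/- **Normal distribution model.** Fix $\sigma>0$ and an integer $T\ge 1$. For each $n$ let $p_n\in[0,1]$ and let $\mathbf u=\mathbf u^{(n)}=(u_1,\dots,u_n)\in\mathbb R^n$ be a deterministic score vector with $u_1=0$ and dynamic range $M_n=\max_{i,j}|u_i-u_j|$. For $1\le i<j\le n$ let the numbers of comparisons $n_{ij}$ be independent $\mathrm{Bin}(T,p_n)$ random variables and, given all the $n_{ij}$, let the outcomes $X_{ij}^{(t)}$, $1\le t\le n_{ij}$, be independent with $X_{ij}^{(t)}\sim N(u_i-u_j,\sigma^2)$. The models for all $n$ are defined on one probability space, with arbitrary joint dependence between different $n$. A maximum likelihood estimate (MLE) is a maximizer $\hat{\mathbf u}$ over $\{\mathbf v\in\mathbb R^n: v_1=0\}$ of $$l(\mathbf v)=\sum_{1\le i<j\le n}\ \sum_{t=1}^{n_{ij}}\log f(X_{ij}^{(t)};v_i-v_j),\qquad f(x;y)=\frac1{\sqrt{2\pi\sigma^2}}e^{-(x-y)^2/(2\sigma^2)} .$$ Assume that for some constant $c>1$ one has $p_n\ge c\,\frac{\log n}{n}$ for all sufficiently large $n$, and that, as $n\to\infty$, $$M_ne^{M_n}\frac{\log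 n}{\log (np_n)}\to 0\qquad\text{and}\qquad \Delta_n:=\sqrt{\frac{\log n}{np_n}}\;\frac{\log n}{\log (np_n)}\to 0 .$$ Then the MLE is uniformly consistent. Precisely, there is a constant $C>0$ depending only on $\sigma$ and $T$ such that for all sufficiently large $n$, with probability at least $1-14n^{-2}$, the MLE $\hat{\mathbf u}$ exists, is unique, and satisfies $\|\hat{\mathbf u}-\mathbf u\|_\infty\le C\Delta_n$. Consequently, almost surely the MLE exists and is unique for all but finitely many $n$, and $\|\hat{\mathbf u}-\mathbf u\|_\infty\to0$. -/

import Mathlib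

open MeasureTheory ProbabilityTheory Filter Topology
open scoped NNReal ENNReal

noncomputable section

/-- The unordered pairs of distinct subjects, listed as `i < j`; subject `i` of `[n]` is the
element `i - 1` of `Fin n`. -/
abbrev Pair (n : ℕ) : Type := {e : Fin n × Fin n // e.1 < e.2}

/-- The conditional log-likelihood given the comparison counts, for outcomes with density
`f x y` at relative score `y`: the outcomes `X e t` with `t < N e` are the observed ones. -/
def logLikelihood (f : ℝ → ℝ → ℝ) {n T : ℕ} (N : Pair n → ℕ) (X : Pair n → Fin T → ℝ)
    (v : Fin n → ℝ) : ℝ :=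
  ∑ e : Pair n, ∑ t ∈ Finset.univ.filter (fun t : Fin T => (t : ℕ) < N e),
    Real.log (f (X e t) (v e.1.1 - v e.1.2))

/-- The parameter space: score vectors whose first coordinate is zero. -/
def scoreSpace (n : ℕ) : Set (Fin n → ℝ) := {v | ∀ i : Fin n, (i : ℕ) = 0 → v i = 0}

/-- `v` is a maximum likelihood estimate: a maximizer of the log-likelihood over the
parameter space. -/
def IsMLE (f : ℝ → ℝ → ℝ) {n T : ℕ} (N : Pair n → ℕ) (X : Pair n → Fin T → ℝ)
    (v : Fin n → ℝ) : Prop :=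
  v ∈ scoreSpace n ∧ IsMaxOn (logLikelihood f N X) (scoreSpace n) v

/-- The density at `x` of the normal distribution with mean `y` and variance `σ ^ 2`. -/
def normalLink (σ : ℝ) (x y : ℝ) : ℝ := gaussianPDFReal y (σ ^ 2).toNNReal x

/-- The normal comparison model on `n` subjects with scores `u`: the counts `N e` are
independent `Bin(T, p)`; given the counts, the outcomes on the pair `(i, j)` are independent
normal variables with mean `u i - u j` and variance `σ ^ 2`, of which the first `N e` are
observed. -/
structure IsNormalComparison {Ω : Type*} [MeasurableSpace Ω] (P : Measure Ω) (σ : ℝ)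
    {n T : ℕ} (p : unitInterval) (u : Fin n → ℝ)
    (N : Pair n → Ω → ℕ) (X : Pair n → Fin T → Ω → ℝ) : Prop where
  count_law : ∀ e, HasLaw (N e) (binomial T p) P
  count_indep : iIndepFun N P
  outcome_law : ∀ e t,
    HasLaw (X e t) (gaussianReal (u e.1.1 - u e.1.2) (σ ^ 2).toNNReal) P
  outcome_indep : iIndepFun (fun et : Pair n × Fin T => X et.1 et.2) P
  count_outcome_indep :
    IndepFun (fun ω e => N e ω) (fun ω (et : Pair n × Fin T) => X et.1 et.2 ω) P

/-- The dynamic range `max_{i,j} |u i - u j|`. -/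
def dynamicRange {n : ℕ} (u : Fin n → ℝ) : ℝ := ⨆ ij : Fin n × Fin n, |u ij.1 - u ij.2|

/-- The rate `Δ_n = sqrt (log n / (n p)) * (log n / log (n p))`. -/
def rate (n : ℕ) (p : ℝ) : ℝ :=
  Real.sqrt (Real.log n / (n * p)) * (Real.log n / Real.log (n * p))

end

/-!
With normal outcomes the likelihood is a least-squares criterion, so the score equation of an
estimate `v` is the graph Laplacian equation `L (v - u) = ε` on the multigraph of observed
comparisons, where `ε i` is the signed sum of the deviations of the outcomes of subject `i` from
their means.

Put `w = v - u`. If `w` is at least `s` on `A` and at least `s - h` exactly on `B`, then summing the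
Laplacian equation over `A` shows that `h` times the number of comparisons leaving `A` for the
complement of `B` is at most `∑ i ∈ A, ε i`. When `A` sends out at least `γ * #A` such comparisons
as long as `#B ≤ ρ * #A`, and `|ε i| < h * γ`, this forces `#B > ρ * #A`: the superlevel sets of `w`
grow by a factor `ρ` at each step `h`. Hence `K = ⌈log n / log ρ⌉` steps down from any value of `w`
reach more than half of the subjects, and so do `K` steps up from any other value, which bounds the
oscillation of `w` by `2 * K * h`. With `ε = 0` the same argument gives uniqueness.

Chernoff bounds and a union bound over the pairs `(A, B)` give the expansion with `γ = n * p / 20`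
and `ρ = n * p / (8 * log n)`, and exponential moments of the noise, first over the outcomes and
then over the counts, give `|ε i| ≤ κ * √(n * p * log n)`. Taking `h` of order
`√(log n / (n * p))` makes `2 * K * h` of the order of the rate, and the Borel-Cantelli lemma
concludes.
-/

section LeastSquares

open Matrix

variable {V E R : Type*} [Fintype V] [Fintype E]

/-- The sum of squared residuals of the linear model `x ≈ B v`. -/
def sqResidual [CommRing R] (B : Matrix E V R) (x : E → R) (v : V → R) : R :=
  (x - B *ᵥ v) ⬝ᵥ (x - B *ᵥ v)

theorem sqResidual_eq_add_of_transpose_mulVec_eq_zero [CommRing R] {B : Matrix E V R}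
    {x : E → R} {v : V → R} (hv : Bᵀ *ᵥ (x - B *ᵥ v) = 0) (w : V → R) :
    sqResidual B x w = sqResidual B x v + (B *ᵥ (w - v)) ⬝ᵥ (B *ᵥ (w - v)) := by
  have horth : (x - B *ᵥ v) ⬝ᵥ (B *ᵥ (w - v)) = 0 := by
    rw [dotProduct_mulVec, ← mulVec_transpose, hv, zero_dotProduct]
  have hsplit : x - B *ᵥ w = (x - B *ᵥ v) - B *ᵥ (w - v) := by
    rw [mulVec_sub]
    abel
  rw [sqResidual, sqResidual, hsplit]
  generalize x - B *ᵥ v = r, B *ᵥ (w - v) = d at horth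
  rw [sub_dotProduct, dotProduct_sub, dotProduct_sub, dotProduct_comm d r, horth]
  ring

variable [Field R] [LinearOrder R] [IsStrictOrderedRing R]

theorem exists_transpose_mulVec_sub_eq_zero (B : Matrix E V R) (x : E → R) :
    ∃ v, Bᵀ *ᵥ (x - B *ᵥ v) = 0 := by
  have hrange : (Bᵀ * B).mulVecLin.range = Bᵀ.mulVecLin.range := by
    refine Submodule.eq_of_le_of_finrank_eq ?_ ?_
    · rw [mulVecLin_mul]
      exact LinearMap.range_comp_le_range _ _
    · change (Bᵀ * B).rank = Bᵀ.rank
      rw [rank_transpose_mul_self, rank_transpose]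
  obtain ⟨v, hv⟩ : Bᵀ *ᵥ x ∈ (Bᵀ * B).mulVecLin.range := hrange ▸ ⟨x, rfl⟩
  exact ⟨v, by rw [mulVec_sub, mulVec_mulVec, sub_eq_zero, ← hv, mulVecLin_apply]⟩

theorem forall_sqResidual_le_iff {B : Matrix E V R} {x : E → R} {S : Set (V → R)}
    (hS : ∀ w, ∃ w' ∈ S, B *ᵥ w' = B *ᵥ w) {v : V → R} :
    (∀ w ∈ S, sqResidual B x v ≤ sqResidual B x w) ↔ Bᵀ *ᵥ (x - B *ᵥ v) = 0 := by
  constructor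
  · intro hmin
    obtain ⟨w, hw⟩ := exists_transpose_mulVec_sub_eq_zero B x
    obtain ⟨w', hw'S, hw'⟩ := hS w
    have hle : sqResidual B x v ≤ sqResidual B x w := by
      simpa only [sqResidual, hw'] using hmin w' hw'S
    rw [sqResidual_eq_add_of_transpose_mulVec_eq_zero hw v] at hle
    have hzero : B *ᵥ (v - w) = 0 := dotProduct_self_eq_zero.1 <|
      le_antisymm (by linarith) (Finset.sum_nonneg fun _ _ => mul_self_nonneg _)
    rwa [← sub_add_cancel v w, mulVec_add, hzero, zero_add]
  · intro hv w _
    rw [sqResidual_eq_add_of_transpose_mulVec_eq_zero hv w]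
    exact le_add_of_nonneg_right (Finset.sum_nonneg fun _ _ => mul_self_nonneg _)

end LeastSquares

section Superlevel

variable {V : Type*} [Fintype V]

/-- The vertices at which `w` is at least `s`. -/
noncomputable def superlevel (w : V → ℝ) (s : ℝ) : Finset V := {j | s ≤ w j}

theorem mem_superlevel {w : V → ℝ} {s : ℝ} {j : V} : j ∈ superlevel w s ↔ s ≤ w j := by
  simp only [superlevel, Finset.mem_filter, Finset.mem_univ, true_and]

theorem superlevel_anti (w : V → ℝ) : Antitone (superlevel w) := fun _ _ hst _ hj =>
  mem_superlevel.2 (hst.trans (mem_superlevel.1 hj))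

end Superlevel

section Multigraph

open Matrix
open scoped Finset

variable {V E : Type*} [DecidableEq V]

/-- The signed incidence matrix of the multigraph in which the edge `a` runs from `(ends a).1` to
`(ends a).2`; loops and parallel edges are allowed. -/
noncomputable def incidence (ends : E → V × V) : Matrix E V ℝ :=
  .of fun a i => (if (ends a).1 = i then 1 else 0) - if (ends a).2 = i then 1 else 0

theorem incidence_mulVec_apply [Fintype V] (ends : E → V × V) (v : V → ℝ) (a : E) :
    (incidence ends *ᵥ v) a = v (ends a).1 - v (ends a).2 := by
  simp [incidence, mulVec, dotProduct, sub_mul, Finset.sum_sub_distrib]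

variable [Fintype E]

/-- The Laplacian of a multigraph. -/
noncomputable def laplacian (ends : E → V × V) : Matrix V V ℝ := (incidence ends)ᵀ * incidence ends

/-- The edges with one end in `A` and the other outside `B`. -/
def edgesLeaving (ends : E → V × V) (A B : Finset V) : Finset E :=
  {a | (ends a).1 ∈ A ∧ (ends a).2 ∉ B ∨ (ends a).2 ∈ A ∧ (ends a).1 ∉ B}

theorem incidence_sq [DecidableEq E] (ends : E → V × V) (a : E) (i : V) :
    incidence ends a i ^ 2 = if a ∈ edgesLeaving ends {i} {i} then 1 else 0 := by
  simp only [incidence, of_apply, edgesLeaving, Finset.mem_filter, Finset.mem_univ, true_and,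
    Finset.mem_singleton]
  split_ifs <;> first | tauto | norm_num

variable [Fintype V]

/-- Edge expansion of a multigraph: every nonempty `A` sends at least `γ * #A` edges out of every
superset `B` that contains at most half of the vertices and has size at most `ρ * #A`. -/
def Expands (ends : E → V × V) (γ ρ : ℝ) : Prop :=
  ∀ A B : Finset V, A.Nonempty → A ⊆ B → 2 * #B ≤ Fintype.card V → (#B : ℝ) ≤ ρ * #A →
    γ * #A ≤ #(edgesLeaving ends A B)

variable {ends : E → V × V}

theorem mul_card_edgesLeaving_superlevel_le (w : V → ℝ) (s h : ℝ) :
    h * #(edgesLeaving ends (superlevel w s) (superlevel w (s - h))) ≤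
      ∑ i ∈ superlevel w s, (laplacian ends *ᵥ w) i := by
  set A := superlevel w s
  set χ : V → ℝ := fun i => if i ∈ A then 1 else 0
  have hflow : ∑ i ∈ A, (laplacian ends *ᵥ w) i =
      ∑ a, (incidence ends *ᵥ w) a * (incidence ends *ᵥ χ) a := by
    change _ = (incidence ends *ᵥ w) ⬝ᵥ (incidence ends *ᵥ χ)
    rw [dotProduct_mulVec, ← mulVec_transpose, mulVec_mulVec]
    simp only [laplacian, dotProduct, χ, mul_ite, mul_one, mul_zero, Finset.sum_ite_mem,
      Finset.univ_inter]
  rw [hflow, mul_comm, ← nsmul_eq_mul, ← Finset.sum_const, edgesLeaving, Finset.sum_filter]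
  refine Finset.sum_le_sum fun a _ => ?_
  simp only [incidence_mulVec_apply, χ, A, mem_superlevel, not_le]
  split_ifs <;> grind

theorem Expands.mul_card_superlevel_lt {γ ρ β h : ℝ} (hexp : Expands ends γ ρ) {w : V → ℝ}
    (hw : ∀ i, (laplacian ends *ᵥ w) i ≤ β) (hβ : β < h * γ) (hh : 0 ≤ h) {s : ℝ}
    (hA : (superlevel w s).Nonempty) (hB : 2 * #(superlevel w (s - h)) ≤ Fintype.card V) :
    ρ * #(superlevel w s) < #(superlevel w (s - h)) := by
  by_contra! hcon
  have hcut := hexp _ _ hA (superlevel_anti w (sub_le_self s hh)) hB hcon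
  have hApos : (0 : ℝ) < #(superlevel w s) := Nat.cast_pos.2 hA.card_pos
  refine (mul_lt_mul_of_pos_right hβ hApos).not_ge ?_
  calc h * γ * #(superlevel w s)
      = h * (γ * #(superlevel w s)) := mul_assoc _ _ _
    _ ≤ h * #(edgesLeaving ends (superlevel w s) (superlevel w (s - h))) := by gcongr
    _ ≤ ∑ i ∈ superlevel w s, (laplacian ends *ᵥ w) i :=
        mul_card_edgesLeaving_superlevel_le w s h
    _ ≤ #(superlevel w s) • β := Finset.sum_le_card_nsmul _ _ _ fun i _ => hw i
    _ = β * #(superlevel w s) := by rw [nsmul_eq_mul, mul_comm]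

theorem Expands.card_lt_two_mul_card_superlevel {γ ρ β h : ℝ} (hexp : Expands ends γ ρ)
    (hρ : 0 ≤ ρ) {w : V → ℝ} (hw : ∀ i, (laplacian ends *ᵥ w) i ≤ β) (hβ : β < h * γ)
    (hh : 0 ≤ h) {K : ℕ} (hK : Fintype.card V ≤ ρ ^ K) (m : V) :
    Fintype.card V < 2 * #(superlevel w (w m - K * h)) := by
  by_contra! hhalf
  have hgrow : ∀ k ≤ K, ρ ^ k ≤ #(superlevel w (w m - k * h)) := by
    intro k hk
    induction k with
    | zero =>
      have hm : m ∈ superlevel w (w m - (0 : ℕ) * h) := mem_superlevel.2 (by simp)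
      simpa using Finset.card_pos.2 ⟨m, hm⟩
    | succ k ih =>
      have hstep : w m - (k + 1 : ℕ) * h = w m - k * h - h := by push_cast; ring
      have hm : m ∈ superlevel w (w m - k * h) :=
        mem_superlevel.2 (sub_le_self _ (by positivity))
      have hsmall : 2 * #(superlevel w (w m - k * h - h)) ≤ Fintype.card V := by
        refine le_trans ?_ hhalf
        gcongr
        refine superlevel_anti w ?_
        rw [← hstep]
        gcongr
      rw [hstep, pow_succ']
      exact (mul_le_mul_of_nonneg_left (ih (by omega)) hρ).trans
        (hexp.mul_card_superlevel_lt hw hβ hh ⟨m, hm⟩ hsmall).le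
  have hall : Fintype.card V ≤ #(superlevel w (w m - K * h)) := by
    exact_mod_cast hK.trans (hgrow K le_rfl)
  have hpos : 0 < Fintype.card V := Fintype.card_pos_iff.2 ⟨m⟩
  omega

theorem Expands.abs_sub_le {γ ρ β h : ℝ} (hexp : Expands ends γ ρ) (hρ : 0 ≤ ρ) {w : V → ℝ}
    (hw : ∀ i, |(laplacian ends *ᵥ w) i| ≤ β) (hβ : β < h * γ) (hh : 0 ≤ h) {K : ℕ}
    (hK : Fintype.card V ≤ ρ ^ K) (i j : V) : |w i - w j| ≤ 2 * K * h := by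
  suffices hsub : ∀ i j, w i - w j ≤ 2 * K * h from abs_sub_le_iff.2 ⟨hsub i j, hsub j i⟩
  intro i j
  have hhigh := hexp.card_lt_two_mul_card_superlevel hρ (fun i => (abs_le.1 (hw i)).2) hβ hh hK i
  have hlow := hexp.card_lt_two_mul_card_superlevel hρ (w := -w)
    (fun i => by rw [mulVec_neg, Pi.neg_apply]; exact neg_le.1 (abs_le.1 (hw i)).1) hβ hh hK j
  obtain ⟨k, hk⟩ : (superlevel w (w i - K * h) ∩ superlevel (-w) ((-w) j - K * h)).Nonempty :=
    Finset.inter_nonempty_of_card_lt_card_add_card (Finset.subset_univ _) (Finset.subset_univ _)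
      (by rw [Finset.card_univ]; omega)
  simp only [Finset.mem_inter, mem_superlevel, Pi.neg_apply] at hk
  linarith [hk.1, hk.2]

theorem Expands.eq_of_laplacian_mulVec_eq_zero {γ ρ : ℝ} (hexp : Expands ends γ ρ) (hγ : 0 < γ)
    (hρ : 0 ≤ ρ) {K : ℕ} (hK : Fintype.card V ≤ ρ ^ K) {w : V → ℝ}
    (hw : laplacian ends *ᵥ w = 0) (i j : V) : w i = w j := by
  have hosc : ∀ h > 0, |w i - w j| ≤ 2 * K * h := fun h hh =>
    hexp.abs_sub_le hρ (β := 0) (by simp [hw]) (by positivity) hh.le hK i j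
  have hlim : Tendsto (fun h : ℝ => 2 * K * h) (𝓝[>] 0) (𝓝 0) :=
    (Continuous.tendsto' (by fun_prop) _ _ (mul_zero _)).mono_left nhdsWithin_le_nhds
  have hzero : |w i - w j| ≤ 0 := ge_of_tendsto hlim (eventually_mem_nhdsWithin.mono hosc)
  exact sub_eq_zero.1 (abs_nonpos_iff.1 hzero)

end Multigraph

section Likelihood

open Matrix

variable {n T : ℕ} {N : Pair n → ℕ}

/-- The observed comparisons, which are the edges of the comparison multigraph on the subjects. -/
abbrev Observed {n : ℕ} (T : ℕ) (N : Pair n → ℕ) : Type :=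
  {a : Pair n × Fin T // (a.2 : ℕ) < N a.1}

/-- The two subjects of an observed comparison, as the ends of an edge of the comparison
multigraph. -/
def comparisonEnds (T : ℕ) (N : Pair n → ℕ) (a : Observed T N) : Fin n × Fin n := a.1.1.1

/-- The outcomes restricted to the observed comparisons. -/
def observedOutcome (N : Pair n → ℕ) (X : Pair n → Fin T → ℝ) (a : Observed T N) : ℝ :=
  X a.1.1 a.1.2

/-- The score function of the least-squares problem at the true scores `u`: subject `i` receives
the signed sum of the deviations of its observed outcomes from their means. -/
noncomputable def noise (u : Fin n → ℝ) (N : Pair n → ℕ) (X : Pair n → Fin T → ℝ) : Fin n → ℝ :=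
  (incidence (comparisonEnds T N))ᵀ *ᵥ
    (observedOutcome N X - incidence (comparisonEnds T N) *ᵥ u)

theorem sum_observed {M : Type*} [AddCommMonoid M] (N : Pair n → ℕ) (f : Pair n × Fin T → M) :
    ∑ a : Observed T N, f a = ∑ e, ∑ t with Fin.val t < N e, f (e, t) := by
  rw [← Finset.sum_subtype {a : Pair n × Fin T | (a.2 : ℕ) < N a.1} (by simp) f]
  simp only [Finset.sum_filter, Fintype.sum_prod_type]

theorem log_normalLink {σ : ℝ} (hσ : σ ≠ 0) (x y : ℝ) :
    Real.log (normalLink σ x y) =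
      Real.log (√(2 * Real.pi * σ ^ 2))⁻¹ - (2 * σ ^ 2)⁻¹ * (x - y) ^ 2 := by
  rw [normalLink, gaussianPDFReal, Real.coe_toNNReal _ (sq_nonneg σ),
    Real.log_mul (by positivity) (Real.exp_ne_zero _), Real.log_exp]
  ring

theorem logLikelihood_normalLink {σ : ℝ} (hσ : σ ≠ 0) (N : Pair n → ℕ) (X : Pair n → Fin T → ℝ)
    (v : Fin n → ℝ) :
    logLikelihood (normalLink σ) N X v =
      Fintype.card (Observed T N) * Real.log (√(2 * Real.pi * σ ^ 2))⁻¹ -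
        (2 * σ ^ 2)⁻¹ *
          sqResidual (incidence (comparisonEnds T N)) (observedOutcome N X) v := by
  have hsum : logLikelihood (normalLink σ) N X v =
      ∑ a : Observed T N, Real.log (normalLink σ (observedOutcome N X a)
        (v (comparisonEnds T N a).1 - v (comparisonEnds T N a).2)) :=
    (sum_observed N fun a => Real.log (normalLink σ (X a.1 a.2) (v a.1.1.1 - v a.1.1.2))).symm
  simp only [hsum, log_normalLink hσ, Finset.sum_sub_distrib, Finset.sum_const, Finset.card_univ,
    nsmul_eq_mul, ← Finset.mul_sum, sqResidual, dotProduct, Pi.sub_apply, incidence_mulVec_apply,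
    sq]

theorem exists_mem_scoreSpace_incidence_mulVec_eq {E : Type*} (ends : E → Fin n × Fin n)
    (w : Fin n → ℝ) : ∃ w' ∈ scoreSpace n, incidence ends *ᵥ w' = incidence ends *ᵥ w := by
  cases n with
  | zero => exact ⟨w, fun i => i.elim0, rfl⟩
  | succ n =>
    refine ⟨fun i => w i - w 0, fun i hi => ?_, ?_⟩
    · exact sub_eq_zero.2 (congrArg w (Fin.ext hi))
    · ext a
      simp only [incidence_mulVec_apply, sub_sub_sub_cancel_right]

theorem isMLE_normalLink_iff {σ : ℝ} (hσ : σ ≠ 0) {X : Pair n → Fin T → ℝ} {v : Fin n → ℝ} :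
    IsMLE (normalLink σ) N X v ↔ v ∈ scoreSpace n ∧
      (incidence (comparisonEnds T N))ᵀ *ᵥ
        (observedOutcome N X - incidence (comparisonEnds T N) *ᵥ v) = 0 := by
  rw [← forall_sqResidual_le_iff (exists_mem_scoreSpace_incidence_mulVec_eq (comparisonEnds T N))]
  refine and_congr_right fun _ => forall₂_congr fun w _ => ?_
  simp only [Set.mem_ofPred_eq, logLikelihood_normalLink hσ]
  rw [sub_le_sub_iff_left, mul_le_mul_iff_right₀ (by positivity)]

theorem exists_isMLE_normalLink {σ : ℝ} (hσ : σ ≠ 0) (N : Pair n → ℕ) (X : Pair n → Fin T → ℝ) :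
    ∃ v, IsMLE (normalLink σ) N X v := by
  obtain ⟨v, hv⟩ :=
    exists_transpose_mulVec_sub_eq_zero (incidence (comparisonEnds T N)) (observedOutcome N X)
  obtain ⟨v', hv'mem, hv'⟩ := exists_mem_scoreSpace_incidence_mulVec_eq (comparisonEnds T N) v
  exact ⟨v', (isMLE_normalLink_iff hσ).2 ⟨hv'mem, by rwa [hv']⟩⟩

theorem IsMLE.laplacian_mulVec_sub {σ : ℝ} (hσ : σ ≠ 0) {X : Pair n → Fin T → ℝ} {v : Fin n → ℝ}
    (hv : IsMLE (normalLink σ) N X v) (u : Fin n → ℝ) :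
    laplacian (comparisonEnds T N) *ᵥ (v - u) = noise u N X := by
  have hscore := ((isMLE_normalLink_iff hσ).1 hv).2
  rw [mulVec_sub, mulVec_mulVec, ← laplacian, sub_eq_zero] at hscore
  rw [noise, mulVec_sub, mulVec_sub, hscore, mulVec_mulVec, ← laplacian]

theorem sub_mem_scoreSpace {v w : Fin n → ℝ} (hv : v ∈ scoreSpace n) (hw : w ∈ scoreSpace n) :
    v - w ∈ scoreSpace n := fun i hi => by rw [Pi.sub_apply, hv i hi, hw i hi, sub_zero]

theorem norm_le_of_mem_scoreSpace {w : Fin n → ℝ} (hw : w ∈ scoreSpace n) {r : ℝ} (hr : 0 ≤ r)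
    (hosc : ∀ i j, |w i - w j| ≤ r) : ‖w‖ ≤ r := by
  refine (pi_norm_le_iff_of_nonneg hr).2 fun i => ?_
  simpa only [Real.norm_eq_abs, hw ⟨0, i.pos⟩ rfl, sub_zero] using hosc i ⟨0, i.pos⟩

/-- The maximum likelihood estimate exists, is unique, and is within sup-distance `r` of `u`. -/
def HasUniqueMLENear (f : ℝ → ℝ → ℝ) (N : Pair n → ℕ) (X : Pair n → Fin T → ℝ)
    (u : Fin n → ℝ) (r : ℝ) : Prop :=
  (∃! v, IsMLE f N X v) ∧ ∀ v, IsMLE f N X v → ‖v - u‖ ≤ r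

theorem hasUniqueMLENear_of_expands {σ : ℝ} (hσ : σ ≠ 0) {X : Pair n → Fin T → ℝ}
    {u : Fin n → ℝ} (hu : u ∈ scoreSpace n) {γ ρ β h : ℝ} {K : ℕ}
    (hexp : Expands (comparisonEnds T N) γ ρ) (hγ : 0 < γ) (hρ : 0 ≤ ρ) (hK : n ≤ ρ ^ K)
    (hnoise : ∀ i, |noise u N X i| ≤ β) (hβ : β < h * γ) (hh : 0 ≤ h) :
    HasUniqueMLENear (normalLink σ) N X u (2 * K * h) := by
  have hK' : (Fintype.card (Fin n) : ℝ) ≤ ρ ^ K := by rwa [Fintype.card_fin]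
  obtain ⟨v, hv⟩ := exists_isMLE_normalLink hσ N X
  refine ⟨⟨v, hv, fun v' hv' => ?_⟩, fun v hv => ?_⟩
  · have hker : laplacian (comparisonEnds T N) *ᵥ (v' - v) = 0 := by
      rw [← sub_sub_sub_cancel_right v' v u, mulVec_sub, hv'.laplacian_mulVec_sub hσ,
        hv.laplacian_mulVec_sub hσ, sub_self]
    have hconst := hexp.eq_of_laplacian_mulVec_eq_zero hγ hρ hK' hker
    refine sub_eq_zero.1 (norm_le_zero_iff.1 ?_)
    exact norm_le_of_mem_scoreSpace (sub_mem_scoreSpace hv'.1 hv.1) le_rfl fun i j => by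
      rw [hconst i j, sub_self, abs_zero]
  · refine norm_le_of_mem_scoreSpace (sub_mem_scoreSpace hv.1 hu) (by positivity) ?_
    refine hexp.abs_sub_le hρ (fun i => ?_) hβ hh hK'
    rw [hv.laplacian_mulVec_sub hσ]
    exact hnoise i

end Likelihood

section ExpMoment

variable {Ω : Type*} [MeasurableSpace Ω] {μ : Measure Ω}

/-- The exponential moment `E[exp f]`, valued in `ℝ≥0∞` so that Chernoff bounds and Tonelli's
theorem apply without integrability side conditions. -/
noncomputable def expMoment (μ : Measure Ω) (f : Ω → ℝ) : ℝ≥0∞ :=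
  ∫⁻ ω, ENNReal.ofReal (Real.exp (f ω)) ∂μ

theorem expMoment_const_mul_eq_ofReal_mgf {f : Ω → ℝ} {s : ℝ}
    (hf : Integrable (fun ω => Real.exp (s * f ω)) μ) :
    expMoment μ (fun ω => s * f ω) = ENNReal.ofReal (mgf f μ s) :=
  (ofReal_integral_eq_lintegral_ofReal hf (ae_of_all _ fun _ => (Real.exp_pos _).le)).symm

theorem expMoment_pi_sum {ι : Type*} [Fintype ι] {α : ι → Type*} [∀ i, MeasurableSpace (α i)]
    (ν : ∀ i, Measure (α i)) [∀ i, IsProbabilityMeasure (ν i)] {f : ∀ i, α i → ℝ}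
    (hf : ∀ i, Measurable (f i)) :
    expMoment (Measure.pi ν) (fun x => ∑ i, f i (x i)) = ∏ i, expMoment (ν i) (f i) := by
  have hmeas : ∀ i, Measurable fun a => ENNReal.ofReal (Real.exp (f i a)) := fun i => by fun_prop
  simp only [expMoment, Real.exp_sum, ENNReal.ofReal_prod_of_nonneg fun _ _ => (Real.exp_pos _).le]
  rw [lintegral_prod_eq_prod_lintegral_of_indepFun (μ := Measure.pi ν) Finset.univ
    (fun i (x : ∀ i, α i) => ENNReal.ofReal (Real.exp (f i (x i))))
    (iIndepFun_pi fun i => (hmeas i).aemeasurable) fun i => (hmeas i).comp (measurable_pi_apply i)]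
  exact Finset.prod_congr rfl fun i _ => (measurePreserving_eval ν i).lintegral_comp (hmeas i)

theorem measure_le_of_expMoment_le {f : Ω → ℝ} (hf : AEMeasurable f μ) {a : ℝ}
    (ha : expMoment μ f ≤ ENNReal.ofReal (Real.exp a)) (y : ℝ) :
    μ {ω | y ≤ f ω} ≤ ENNReal.ofReal (Real.exp (a - y)) := by
  have hset : {ω | y ≤ f ω} =
      {ω | ENNReal.ofReal (Real.exp y) ≤ ENNReal.ofReal (Real.exp (f ω))} := by
    simp only [ENNReal.ofReal_le_ofReal_iff (Real.exp_pos _).le, Real.exp_le_exp]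
  calc μ {ω | y ≤ f ω}
      ≤ expMoment μ f / ENNReal.ofReal (Real.exp y) := hset ▸ meas_ge_le_lintegral_div
        (by fun_prop) (ENNReal.ofReal_pos.2 (Real.exp_pos y)).ne' ENNReal.ofReal_ne_top
    _ ≤ ENNReal.ofReal (Real.exp a) / ENNReal.ofReal (Real.exp y) := by gcongr
    _ = ENNReal.ofReal (Real.exp (a - y)) := by
      rw [Real.exp_sub, ENNReal.ofReal_div_of_pos (Real.exp_pos y)]

theorem measure_le_abs_of_expMoment_le {f : Ω → ℝ} (hf : AEMeasurable f μ) {l a : ℝ} (hl : 0 ≤ l)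
    (hpos : expMoment μ (fun ω => l * f ω) ≤ ENNReal.ofReal (Real.exp a))
    (hneg : expMoment μ (fun ω => -l * f ω) ≤ ENNReal.ofReal (Real.exp a)) (y : ℝ) :
    μ {ω | y ≤ |f ω|} ≤ ENNReal.ofReal (2 * Real.exp (a - l * y)) := by
  have hsub : {ω | y ≤ |f ω|} ⊆ {ω | l * y ≤ l * f ω} ∪ {ω | l * y ≤ -l * f ω} := by
    intro ω hω
    rcases le_abs.1 (show y ≤ |f ω| from hω) with hy | hy
    · exact .inl (mul_le_mul_of_nonneg_left hy hl)
    · refine .inr ((mul_le_mul_of_nonneg_left hy hl).trans_eq ?_)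
      rw [mul_neg, neg_mul]
  calc μ {ω | y ≤ |f ω|}
      ≤ μ {ω | l * y ≤ l * f ω} + μ {ω | l * y ≤ -l * f ω} :=
        (measure_mono hsub).trans (measure_union_le _ _)
    _ ≤ ENNReal.ofReal (Real.exp (a - l * y)) + ENNReal.ofReal (Real.exp (a - l * y)) :=
        add_le_add (measure_le_of_expMoment_le (hf.const_mul l) hpos _)
          (measure_le_of_expMoment_le (hf.const_mul (-l)) hneg _)
    _ = ENNReal.ofReal (2 * Real.exp (a - l * y)) := by
      rw [← ENNReal.ofReal_add (Real.exp_pos _).le (Real.exp_pos _).le, two_mul]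

theorem mgf_binomial (T : ℕ) (p : unitInterval) (s : ℝ) :
    mgf (fun k : ℕ => (k : ℝ)) (binomial T p) s = (p * Real.exp s + (1 - p)) ^ T := by
  rw [mgf, integral_binomial, add_pow]
  refine Finset.sum_congr (by ext; simp) fun k _ => ?_
  rw [smul_eq_mul, mul_comm s, Real.exp_nat_mul, mul_pow]
  ring

theorem expMoment_binomial_le (T : ℕ) (p : unitInterval) (s : ℝ) :
    expMoment (binomial T p) (fun k => s * k) ≤
      ENNReal.ofReal (Real.exp (T * p * (Real.exp s - 1))) := by
  rw [expMoment_const_mul_eq_ofReal_mgf (integrable_binomial _), mgf_binomial]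
  refine ENNReal.ofReal_le_ofReal ?_
  have hbase : 0 ≤ p * Real.exp s + (1 - p) :=
    add_nonneg (mul_nonneg p.2.1 (Real.exp_pos s).le) (sub_nonneg.2 p.2.2)
  rw [mul_assoc, Real.exp_nat_mul]
  refine pow_le_pow_left₀ hbase ?_ T
  linarith [Real.add_one_le_exp ((p : ℝ) * (Real.exp s - 1))]

theorem expMoment_pi_binomial_sum_le {ι : Type*} [Fintype ι] (T : ℕ) (p : unitInterval)
    (S : Finset ι) (s : ℝ) :
    expMoment (Measure.pi fun _ : ι => binomial T p) (fun k => s * ∑ i ∈ S, (k i : ℝ)) ≤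
      ENNReal.ofReal (Real.exp (S.card * (T * p * (Real.exp s - 1)))) := by
  classical
  have hsum : ∀ k : ι → ℕ,
      s * ∑ i ∈ S, (k i : ℝ) = ∑ i, (if i ∈ S then s else 0) * (k i : ℝ) := fun k => by
    simp only [ite_mul, zero_mul, Finset.sum_ite_mem, Finset.univ_inter, Finset.mul_sum]
  have hprod : Real.exp (S.card * (T * p * (Real.exp s - 1))) =
      ∏ i, Real.exp (T * p * (Real.exp (if i ∈ S then s else 0) - 1)) := by
    rw [← Real.exp_sum, ← nsmul_eq_mul, ← Finset.sum_const, ← Finset.univ_inter S,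
      ← Finset.sum_ite_mem, Finset.univ_inter]
    congr! 2 with i
    split_ifs <;> simp
  simp only [hsum, hprod, ENNReal.ofReal_prod_of_nonneg fun _ _ => (Real.exp_pos _).le]
  rw [expMoment_pi_sum (fun _ : ι => binomial T p)
    (f := fun i (k : ℕ) => (if i ∈ S then s else 0) * (k : ℝ)) fun _ => .of_discrete]
  exact Finset.prod_le_prod' fun i _ => expMoment_binomial_le T p _

theorem expMoment_gaussianReal (m : ℝ) (v : ℝ≥0) (a : ℝ) :
    expMoment (gaussianReal m v) (fun x => a * (x - m)) =
      ENNReal.ofReal (Real.exp (v * a ^ 2 / 2)) := by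
  have hlaw : (gaussianReal m v).map (· - m) = gaussianReal 0 v := by
    rw [gaussianReal_map_sub_const, sub_self]
  have hint : Integrable (fun x => Real.exp (a * (x - m))) (gaussianReal m v) :=
    (integrable_map_measure (g := fun x => Real.exp (a * x)) (by fun_prop) (by fun_prop)).1
      (hlaw ▸ integrable_exp_mul_gaussianReal a)
  rw [expMoment_const_mul_eq_ofReal_mgf hint, mgf_gaussianReal hlaw, zero_mul, zero_add]

theorem expMoment_pi_gaussianReal {ι : Type*} [Fintype ι] (m : ι → ℝ) (v : ℝ≥0) (a : ι → ℝ) :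
    expMoment (Measure.pi fun i => gaussianReal (m i) v) (fun x => ∑ i, a i * (x i - m i)) =
      ENNReal.ofReal (Real.exp (v / 2 * ∑ i, a i ^ 2)) := by
  rw [expMoment_pi_sum (fun i => gaussianReal (m i) v) (f := fun i x => a i * (x - m i))
    fun i => by fun_prop]
  simp only [expMoment_gaussianReal]
  rw [← ENNReal.ofReal_prod_of_nonneg fun _ _ => (Real.exp_pos _).le, ← Real.exp_sum,
    Finset.mul_sum]
  congr! 3 with i
  ring

end ExpMoment

section ComparisonGraph

open scoped Finset

variable {n : ℕ}

theorem card_edgesLeaving_pair {A B : Finset (Fin n)} (hAB : A ⊆ B) :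
    #(edgesLeaving (Subtype.val : Pair n → Fin n × Fin n) A B) = #A * (n - #B) := by
  have htarget : #(A ×ˢ Bᶜ) = #A * (n - #B) := by
    rw [Finset.card_product, Finset.card_compl, Fintype.card_fin]
  rw [← htarget]
  refine Finset.card_nbij (fun e => if e.1.1 ∈ A then e.1 else e.1.swap) ?_ ?_ ?_
  · intro e he
    rw [edgesLeaving] at he
    grind [Finset.mem_compl]
  · rintro ⟨⟨i, j⟩, hij⟩ _ ⟨⟨i', j'⟩, hij'⟩ _ heq
    grind
  · rintro ⟨i, j⟩ hij
    simp only [Finset.coe_product, Set.mem_prod, Finset.mem_coe, Finset.mem_compl] at hij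
    have hj : j ∉ A := fun h => hij.2 (hAB h)
    rcases lt_or_gt_of_ne (ne_of_mem_of_not_mem hij.1 hj) with hlt | hlt
    · exact ⟨⟨(i, j), hlt⟩, by simp [edgesLeaving, hij.1, hij.2], by simp [hij.1]⟩
    · exact ⟨⟨(j, i), hlt⟩, by simp [edgesLeaving, hij.1, hij.2], by simp [hj]⟩

theorem card_edgesLeaving_comparisonEnds {T : ℕ} {N : Pair n → ℕ} (hN : ∀ e, N e ≤ T)
    (A B : Finset (Fin n)) :
    #(edgesLeaving (comparisonEnds T N) A B) = ∑ e ∈ edgesLeaving Subtype.val A B, N e := by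
  calc #(edgesLeaving (comparisonEnds T N) A B)
      = ∑ a : Observed T N, if a.1.1 ∈ edgesLeaving Subtype.val A B then 1 else 0 := by
        rw [edgesLeaving, Finset.card_filter]
        simp only [edgesLeaving, Finset.mem_filter, Finset.mem_univ, true_and]
        rfl
    _ = ∑ e, ∑ t : Fin T with t.val < N e, if e ∈ edgesLeaving Subtype.val A B then 1 else 0 :=
        sum_observed N fun a => if a.1 ∈ edgesLeaving Subtype.val A B then 1 else 0
    _ = ∑ e ∈ edgesLeaving Subtype.val A B, N e := by
        simp only [Finset.sum_const, Fin.card_filter_val_lt, min_eq_right (hN _), smul_eq_mul,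
          mul_ite, mul_one, mul_zero, Finset.sum_ite_mem, Finset.univ_inter]

theorem noise_apply {T : ℕ} (u : Fin n → ℝ) (N : Pair n → ℕ) (X : Pair n → Fin T → ℝ)
    (i : Fin n) :
    noise u N X i = ∑ a : Pair n × Fin T,
      (if (a.2 : ℕ) < N a.1 then incidence Subtype.val a.1 i else 0) *
        (X a.1 a.2 - (u a.1.1.1 - u a.1.1.2)) := by
  simp only [Fintype.sum_prod_type, ite_mul, zero_mul]
  simp only [← Finset.sum_filter]
  rw [← sum_observed N fun a => incidence Subtype.val a.1 i *
    (X a.1 a.2 - (u a.1.1.1 - u a.1.1.2))]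
  refine Finset.sum_congr rfl fun a _ => ?_
  rw [Pi.sub_apply, incidence_mulVec_apply]
  rfl

end ComparisonGraph

section ComparisonLaw

open scoped Finset

variable {n T : ℕ} {p : unitInterval}

theorem ae_forall_le_of_pi_binomial {ι : Type*} [Fintype ι] (T : ℕ) (p : unitInterval) :
    ∀ᵐ k ∂Measure.pi (fun _ : ι => binomial T p), ∀ i, k i ≤ T :=
  ae_all_iff.2 fun _ =>
    Measure.tendsto_eval_ae_ae.eventually (p := (· ≤ T)) (ae_le_of_hasLaw_binomial .id)

theorem measure_sum_binomial_le {ι : Type*} [Fintype ι] (T : ℕ) (p : unitInterval)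
    (S : Finset ι) (y : ℝ) :
    Measure.pi (fun _ : ι => binomial T p) {k | ∑ i ∈ S, (k i : ℝ) ≤ y} ≤
      ENNReal.ofReal (Real.exp (y - #S * (T * p * (1 - Real.exp (-1))))) := by
  have hchernoff := measure_le_of_expMoment_le (.of_discrete)
    (expMoment_pi_binomial_sum_le T p S (-1)) (-y)
  simp only [neg_one_mul, neg_le_neg_iff] at hchernoff
  convert hchernoff using 3
  ring

theorem sum_pow_card_mul_pow_card_le (hn : 0 < n) :
    ∑ AB : Finset (Fin n) × Finset (Fin n), (1 / (n : ℝ)) ^ #AB.1 * (1 / (n : ℝ)) ^ #AB.2 ≤ 9 := by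
  have hn' : (0 : ℝ) < n := Nat.cast_pos.2 hn
  have hsingle : ∑ A : Finset (Fin n), (1 / (n : ℝ)) ^ #A ≤ 3 :=
    calc ∑ A : Finset (Fin n), (1 / (n : ℝ)) ^ #A = (1 / (n : ℝ) + 1) ^ n := by
          simpa using Fintype.sum_pow_mul_eq_add_pow (Fin n) (1 / (n : ℝ)) 1
      _ ≤ Real.exp (1 / n) ^ n :=
          pow_le_pow_left₀ (by positivity) (Real.add_one_le_exp _) n
      _ = Real.exp 1 := by rw [← Real.exp_nat_mul, mul_one_div_cancel hn'.ne']
      _ ≤ 3 := Real.exp_one_lt_three.le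
  simp only [Fintype.sum_prod_type]
  rw [← Fintype.sum_mul_sum]
  exact (mul_le_mul hsingle hsingle (by positivity) zero_le_three).trans_eq (by norm_num)

theorem measure_sum_edgesLeaving_le (hT : 1 ≤ T) (hn : 2 ≤ n) (hnp : 32 * Real.log n ≤ n * p)
    {A B : Finset (Fin n)} (hA : A.Nonempty) (hAB : A ⊆ B) (hB : 2 * #B ≤ n)
    (hBA : (#B : ℝ) ≤ n * p / (8 * Real.log n) * #A) :
    Measure.pi (fun _ : Pair n => binomial T p)
        {k | ∑ e ∈ edgesLeaving Subtype.val A B, (k e : ℝ) ≤ n * p / 20 * #A} ≤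
      ENNReal.ofReal ((1 / (n : ℝ)) ^ 3 * ((1 / (n : ℝ)) ^ #A * (1 / (n : ℝ)) ^ #B)) := by
  have hn0 : (0 : ℝ) < n := by positivity
  have hL : 0 < Real.log n := Real.log_pos (by exact_mod_cast hn)
  have hpow : ∀ m : ℕ, (1 / (n : ℝ)) ^ m = Real.exp (-(m * Real.log n)) := fun m => by
    rw [Real.exp_neg, Real.exp_nat_mul, Real.exp_log hn0, one_div, inv_pow]
  refine (measure_sum_binomial_le T p _ _).trans (ENNReal.ofReal_le_ofReal ?_)
  rw [hpow, hpow, hpow, ← Real.exp_add, ← Real.exp_add, Real.exp_le_exp]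
  -- The cut has mean at least `n * p / 2 * #A`, so the Chernoff exponent, after subtracting
  -- `n * p / 20 * #A`, exceeds `0.26 * n * p * #A`; this pays for `(#A + #B + 3) * log n`
  -- because `32 * log n ≤ n * p` and `#B * log n ≤ n * p / 8 * #A`.
  have hA1 : (1 : ℝ) ≤ #A := by exact_mod_cast hA.card_pos
  have hcut : (#A : ℝ) * (n / 2) ≤ #(edgesLeaving (Subtype.val : Pair n → _) A B) := by
    have hB' : 2 * (#B : ℝ) ≤ n := by exact_mod_cast hB
    rw [card_edgesLeaving_pair hAB, Nat.cast_mul, Nat.cast_sub (by omega)]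
    gcongr
    linarith
  have hmean : (p : ℝ) * 0.632 ≤ T * p * (1 - Real.exp (-1)) := by
    have hTp : (p : ℝ) ≤ T * p := le_mul_of_one_le_left p.2.1 (by exact_mod_cast hT)
    exact mul_le_mul hTp (by linarith [Real.exp_neg_one_lt_d9]) (by norm_num)
      (p.2.1.trans hTp)
  have hprod : (#A : ℝ) * (n / 2) * (p * 0.632) ≤
      #(edgesLeaving (Subtype.val : Pair n → _) A B) * (T * p * (1 - Real.exp (-1))) :=
    mul_le_mul hcut hmean (mul_nonneg p.2.1 (by norm_num)) (by positivity)
  have hBlog : (#B : ℝ) * Real.log n ≤ #A * (n * p) / 8 :=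
    (mul_le_mul_of_nonneg_right hBA hL.le).trans_eq (by field_simp)
  have hAnp : (#A : ℝ) * (32 * Real.log n) ≤ #A * (n * p) := by gcongr
  have hAlog : Real.log n ≤ #A * Real.log n := le_mul_of_one_le_left hL.le hA1
  push_cast
  linarith

theorem measure_not_expands_le (hT : 1 ≤ T) (hn : 2 ≤ n) (hnp : 32 * Real.log n ≤ n * p) :
    Measure.pi (fun _ : Pair n => binomial T p)
        {k | ¬ Expands (comparisonEnds T k) (n * p / 20) (n * p / (8 * Real.log n))} ≤
      ENNReal.ofReal (9 / (n : ℝ) ^ 3) := by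
  classical
  set ρ := (n * p : ℝ) / (8 * Real.log n)
  set cuts : Finset (Finset (Fin n) × Finset (Fin n)) :=
    {AB | AB.1.Nonempty ∧ AB.1 ⊆ AB.2 ∧ 2 * #AB.2 ≤ n ∧ (#AB.2 : ℝ) ≤ ρ * #AB.1}
  set sparse : Finset (Fin n) × Finset (Fin n) → Set (Pair n → ℕ) := fun AB =>
    {k | ∑ e ∈ edgesLeaving Subtype.val AB.1 AB.2, (k e : ℝ) ≤ n * p / 20 * #AB.1}
  set weight : Finset (Fin n) × Finset (Fin n) → ℝ := fun AB =>
    (1 / (n : ℝ)) ^ 3 * ((1 / (n : ℝ)) ^ #AB.1 * (1 / (n : ℝ)) ^ #AB.2)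
  have hcover : ∀ᵐ k ∂Measure.pi fun _ : Pair n => binomial T p,
      ¬ Expands (comparisonEnds T k) (n * p / 20) ρ → ∃ AB ∈ cuts, k ∈ sparse AB := by
    filter_upwards [ae_forall_le_of_pi_binomial T p] with k hk hbad
    simp only [Expands, Fintype.card_fin, not_forall, not_le, exists_prop] at hbad
    obtain ⟨A, B, hA, hAB, hB, hBA, hlt⟩ := hbad
    rw [card_edgesLeaving_comparisonEnds hk, Nat.cast_sum] at hlt
    exact ⟨(A, B), by simp [cuts, hA, hAB, hB, hBA], hlt.le⟩
  have hsparse : ∀ AB ∈ cuts, Measure.pi (fun _ : Pair n => binomial T p) (sparse AB) ≤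
      ENNReal.ofReal (weight AB) := fun AB hAB => by
    obtain ⟨hA, hAB, hB, hBA⟩ := (Finset.mem_filter.1 hAB).2
    exact measure_sum_edgesLeaving_le hT hn hnp hA hAB hB hBA
  have hweight : ∑ AB ∈ cuts, weight AB ≤ 9 / (n : ℝ) ^ 3 := by
    refine (Finset.sum_le_univ_sum_of_nonneg fun _ => by positivity).trans ?_
    rw [← Finset.mul_sum]
    refine (mul_le_mul_of_nonneg_left (sum_pow_card_mul_pow_card_le (by omega))
      (by positivity)).trans_eq ?_
    ring
  refine (measure_mono_ae (hcover.mono fun k hk hbad => Set.mem_iUnion₂.2 <| by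
    simpa only [exists_prop] using hk hbad)).trans ((measure_biUnion_finset_le _ _).trans ?_)
  refine (Finset.sum_le_sum hsparse).trans ?_
  rw [← ENNReal.ofReal_sum_of_nonneg fun _ _ => by positivity]
  exact ENNReal.ofReal_le_ofReal hweight

end ComparisonLaw

section Noise

open scoped Finset

variable {n T : ℕ} {p : unitInterval}

/-- The joint law of all the potential outcomes in the normal model with scores `u`. -/
noncomputable abbrev outcomeLaw (σ : ℝ) (T : ℕ) (u : Fin n → ℝ) : Measure (Pair n × Fin T → ℝ) :=
  Measure.pi fun a => gaussianReal (u a.1.1.1 - u a.1.1.2) (σ ^ 2).toNNReal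

/-- The joint law of the comparison counts and the potential outcomes in the normal model. -/
noncomputable abbrev comparisonLaw (σ : ℝ) (T : ℕ) (p : unitInterval) (u : Fin n → ℝ) :
    Measure ((Pair n → ℕ) × (Pair n × Fin T → ℝ)) :=
  (Measure.pi fun _ => binomial T p).prod (outcomeLaw σ T u)

theorem measurable_noise (u : Fin n → ℝ) (i : Fin n) :
    Measurable fun z : (Pair n → ℕ) × (Pair n × Fin T → ℝ) =>
      noise u z.1 (Function.curry z.2) i := by
  simp only [noise_apply, Function.curry]
  refine Finset.measurable_sum _ fun a _ => .mul (.ite ?_ ?_ ?_) ?_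
  · exact measurableSet_lt measurable_const (by fun_prop)
  all_goals fun_prop

theorem sum_sq_observed_incidence (N : Pair n → ℕ) (i : Fin n) :
    ∑ a : Pair n × Fin T, (if (a.2 : ℕ) < N a.1 then incidence Subtype.val a.1 i else 0) ^ 2 =
      (#(edgesLeaving (comparisonEnds T N) {i} {i}) : ℝ) := by
  calc ∑ a : Pair n × Fin T,
        (if (a.2 : ℕ) < N a.1 then incidence Subtype.val a.1 i else 0) ^ 2
      = ∑ a : Observed T N, incidence Subtype.val a.1.1 i ^ 2 := by
        rw [sum_observed N fun a => incidence Subtype.val a.1 i ^ 2]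
        simp only [Fintype.sum_prod_type, Finset.sum_filter, ite_pow, zero_pow two_ne_zero]
    _ = ∑ a : Observed T N, incidence (comparisonEnds T N) a i ^ 2 := rfl
    _ = #(edgesLeaving (comparisonEnds T N) {i} {i}) := by
        simp only [incidence_sq, Finset.sum_boole, Finset.filter_univ_mem]

theorem expMoment_outcomeLaw_noise (σ : ℝ) (u : Fin n → ℝ) (N : Pair n → ℕ) (i : Fin n) (l : ℝ) :
    expMoment (outcomeLaw σ T u) (fun x => l * noise u N (Function.curry x) i) =
      ENNReal.ofReal (Real.exp
        (σ ^ 2 * l ^ 2 / 2 * #(edgesLeaving (comparisonEnds T N) {i} {i}))) := by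
  simp only [noise_apply, Function.curry, Finset.mul_sum, ← mul_assoc]
  rw [expMoment_pi_gaussianReal (fun a : Pair n × Fin T => u a.1.1.1 - u a.1.1.2),
    Real.coe_toNNReal _ (sq_nonneg σ)]
  simp only [mul_pow, ← Finset.mul_sum, sum_sq_observed_incidence]
  ring_nf

theorem expMoment_comparisonLaw_noise_le (σ : ℝ) (T : ℕ) (p : unitInterval) (u : Fin n → ℝ)
    (i : Fin n) (l : ℝ) :
    expMoment (comparisonLaw σ T p u) (fun z => l * noise u z.1 (Function.curry z.2) i) ≤
      ENNReal.ofReal (Real.exp (n * (T * p * (Real.exp (σ ^ 2 * l ^ 2 / 2) - 1)))) := by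
  set S : Finset (Pair n) := edgesLeaving Subtype.val {i} {i}
  have hS : (#S : ℝ) ≤ n := by
    rw [card_edgesLeaving_pair subset_rfl, Finset.card_singleton, one_mul]
    exact_mod_cast n.sub_le 1
  have hmgf : 0 ≤ Real.exp (σ ^ 2 * l ^ 2 / 2) - 1 := by
    linarith [Real.one_le_exp (show 0 ≤ σ ^ 2 * l ^ 2 / 2 by positivity)]
  calc expMoment (comparisonLaw σ T p u) (fun z => l * noise u z.1 (Function.curry z.2) i)
      = ∫⁻ k, expMoment (outcomeLaw σ T u) (fun x => l * noise u k (Function.curry x) i)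
          ∂Measure.pi fun _ => binomial T p :=
        lintegral_prod _ ((measurable_noise u i).const_mul l).exp.ennreal_ofReal.aemeasurable
    _ = expMoment (Measure.pi fun _ => binomial T p)
          (fun k => σ ^ 2 * l ^ 2 / 2 * ∑ e ∈ S, (k e : ℝ)) := by
        refine lintegral_congr_ae ((ae_forall_le_of_pi_binomial T p).mono fun k hk => ?_)
        simp only [expMoment_outcomeLaw_noise, card_edgesLeaving_comparisonEnds hk, Nat.cast_sum, S]
    _ ≤ ENNReal.ofReal (Real.exp (#S * (T * p * (Real.exp (σ ^ 2 * l ^ 2 / 2) - 1)))) :=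
        expMoment_pi_binomial_sum_le T p S _
    _ ≤ ENNReal.ofReal (Real.exp (n * (T * p * (Real.exp (σ ^ 2 * l ^ 2 / 2) - 1)))) := by
        have := p.2.1
        gcongr

theorem measure_le_abs_noise_le (σ : ℝ) (u : Fin n → ℝ) (i : Fin n) {l : ℝ} (hl : 0 ≤ l)
    (hσl : σ ^ 2 * l ^ 2 ≤ 2) (y : ℝ) :
    comparisonLaw σ T p u {z | y ≤ |noise u z.1 (Function.curry z.2) i|} ≤
      ENNReal.ofReal (2 * Real.exp (T * σ ^ 2 * (n * p * l ^ 2) - l * y)) := by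
  have hexp : Real.exp (σ ^ 2 * l ^ 2 / 2) - 1 ≤ σ ^ 2 * l ^ 2 := by
    have habs : |σ ^ 2 * l ^ 2 / 2| ≤ 1 := by
      rw [abs_of_nonneg (by positivity)]
      linarith
    have hbound := Real.abs_exp_sub_one_le habs
    rw [abs_of_nonneg (by positivity : 0 ≤ σ ^ 2 * l ^ 2 / 2)] at hbound
    linarith [le_abs_self (Real.exp (σ ^ 2 * l ^ 2 / 2) - 1)]
  have hpos : ∀ s : ℝ, s ^ 2 = l ^ 2 →
      expMoment (comparisonLaw σ T p u) (fun z => s * noise u z.1 (Function.curry z.2) i) ≤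
        ENNReal.ofReal (Real.exp (T * σ ^ 2 * (n * p * l ^ 2))) := fun s hs => by
    refine (expMoment_comparisonLaw_noise_le σ T p u i s).trans ?_
    rw [hs]
    have hp : (0 : ℝ) ≤ p := p.2.1
    calc ENNReal.ofReal (Real.exp (n * (T * p * (Real.exp (σ ^ 2 * l ^ 2 / 2) - 1))))
        ≤ ENNReal.ofReal (Real.exp (n * (T * p * (σ ^ 2 * l ^ 2)))) := by gcongr
      _ = ENNReal.ofReal (Real.exp (T * σ ^ 2 * (n * p * l ^ 2))) := by ring_nf
  exact measure_le_abs_of_expMoment_le (measurable_noise u i).aemeasurable hl (hpos l rfl)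
    (hpos (-l) (neg_sq l)) y

theorem measure_exists_le_abs_noise_le (σ : ℝ) (u : Fin n → ℝ) (hn : 2 ≤ n)
    (hnp : 0 < n * (p : ℝ)) (hσp : σ ^ 2 * Real.log n ≤ 2 * (n * p)) :
    comparisonLaw σ T p u {z | ∃ i, (T * σ ^ 2 + 4) * √(n * p * Real.log n) ≤
        |noise u z.1 (Function.curry z.2) i|} ≤
      ENNReal.ofReal (2 / (n : ℝ) ^ 3) := by
  have hn0 : (0 : ℝ) < n := by positivity
  have hL : 0 < Real.log n := Real.log_pos (by exact_mod_cast hn)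
  set l := √(Real.log n / (n * p))
  have hl : l ^ 2 = Real.log n / (n * p) := Real.sq_sqrt (by positivity)
  have hσl : σ ^ 2 * l ^ 2 ≤ 2 := by
    rwa [hl, ← mul_div_assoc, div_le_iff₀ hnp]
  have hly : l * √(n * p * Real.log n) = Real.log n := by
    rw [← Real.sqrt_mul (by positivity), div_mul_eq_mul_div, mul_left_comm,
      mul_div_cancel_left₀ _ hnp.ne', Real.sqrt_mul_self hL.le]
  have hexponent : T * σ ^ 2 * (n * p * l ^ 2) - l * ((T * σ ^ 2 + 4) * √(n * p * Real.log n)) =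
      -((4 : ℕ) * Real.log n) := by
    rw [mul_left_comm l, hly, hl, mul_div_cancel₀ _ hnp.ne']
    push_cast
    ring
  have htail : ∀ i, comparisonLaw σ T p u {z | (T * σ ^ 2 + 4) * √(n * p * Real.log n) ≤
      |noise u z.1 (Function.curry z.2) i|} ≤ ENNReal.ofReal (2 * ((n : ℝ) ^ 4)⁻¹) := fun i => by
    refine (measure_le_abs_noise_le σ u i (Real.sqrt_nonneg _) hσl _).trans_eq ?_
    rw [hexponent, Real.exp_neg, Real.exp_nat_mul, Real.exp_log hn0]
  rw [Set.ofPred_exists]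
  refine (measure_iUnion_fintype_le _ _).trans ((Finset.sum_le_sum fun i _ => htail i).trans_eq ?_)
  rw [Finset.sum_const, Finset.card_univ, Fintype.card_fin, nsmul_eq_mul,
    ← ENNReal.ofReal_natCast, ← ENNReal.ofReal_mul hn0.le]
  congr 1
  field_simp

end Noise

section Nonasymptotic

variable {n T : ℕ} {p : unitInterval} {u : Fin n → ℝ}

theorem exists_le_pow_of_log_div_four_le {x y ρ : ℝ} (hy : 1 < y) (hyx : y ≤ x) (hρ : 0 < ρ)
    (hlogρ : Real.log y / 4 ≤ Real.log ρ) :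
    ∃ K : ℕ, x ≤ ρ ^ K ∧ K ≤ 5 * (Real.log x / Real.log y) := by
  have hlogy : 0 < Real.log y := Real.log_pos hy
  have hlogx : 0 < Real.log x := Real.log_pos (hy.trans_le hyx)
  have hpos : 0 < Real.log ρ := (by positivity : 0 < Real.log y / 4).trans_le hlogρ
  refine ⟨⌈Real.log x / Real.log ρ⌉₊, ?_, ?_⟩
  · rw [Real.le_pow_iff_log_le (by linarith) hρ, ← div_le_iff₀ hpos]
    exact Nat.le_ceil _
  · have hratio : 1 ≤ Real.log x / Real.log y :=
      (one_le_div hlogy).2 (Real.log_le_log (by linarith) hyx)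
    calc (⌈Real.log x / Real.log ρ⌉₊ : ℝ)
        ≤ Real.log x / Real.log ρ + 1 := (Nat.ceil_lt_add_one (by positivity)).le
      _ ≤ Real.log x / (Real.log y / 4) + Real.log x / Real.log y := by gcongr
      _ = 5 * (Real.log x / Real.log y) := by
        field_simp
        norm_num

theorem hasUniqueMLENear_rate_of_expands {σ κ : ℝ} (hσ : σ ≠ 0) (hκ : 0 < κ)
    (hu : u ∈ scoreSpace n) (hnp : 1 < n * (p : ℝ))
    (hρ : Real.log (n * p) / 4 ≤ Real.log (n * p / (8 * Real.log n)))
    {N : Pair n → ℕ} {X : Pair n → Fin T → ℝ}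
    (hexp : Expands (comparisonEnds T N) (n * p / 20) (n * p / (8 * Real.log n)))
    (hnoise : ∀ i, |noise u N X i| ≤ κ * √(n * p * Real.log n)) :
    HasUniqueMLENear (normalLink σ) N X u (400 * κ * rate n p) := by
  have hle : n * (p : ℝ) ≤ n := mul_le_of_le_one_right n.cast_nonneg p.2.2
  have hL : 0 < Real.log n := Real.log_pos (hnp.trans_le hle)
  obtain ⟨K, hK, hKle⟩ := exists_le_pow_of_log_div_four_le hnp hle (by positivity) hρ
  set h := 40 * κ * √(Real.log n / (n * p))
  have hsqrt : √(Real.log n / (n * p)) * (n * p) = √(n * p * Real.log n) := by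
    rw [← Real.sqrt_sq (zero_le_one.trans hnp.le), ← Real.sqrt_mul (by positivity),
      Real.sqrt_sq (zero_le_one.trans hnp.le)]
    congr 1
    field_simp
  have hbalance : κ * √(n * p * Real.log n) < h * (n * p / 20) := by
    have hpos : 0 < κ * √(n * p * Real.log n) := by positivity
    calc κ * √(n * p * Real.log n) < 2 * (κ * √(n * p * Real.log n)) := by linarith
      _ = h * (n * p / 20) := by rw [← hsqrt]; ring
  have hradius : 2 * K * h ≤ 400 * κ * rate n p :=
    calc 2 * K * h ≤ 2 * (5 * (Real.log n / Real.log (n * p))) * h := by gcongr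
      _ = 400 * κ * rate n p := by rw [rate]; ring
  obtain ⟨hunique, hnear⟩ := hasUniqueMLENear_of_expands hσ hu hexp (by positivity)
    (by positivity) hK hnoise hbalance (by positivity)
  exact ⟨hunique, fun v hv => (hnear v hv).trans hradius⟩

theorem measure_not_hasUniqueMLENear_le {σ : ℝ} (hσ : σ ≠ 0) (hu : u ∈ scoreSpace n)
    (hT : 1 ≤ T) (hn : 2 ≤ n) (hnp : 32 * Real.log n ≤ n * p)
    (hσp : σ ^ 2 * Real.log n ≤ 2 * (n * p))
    (hρ : Real.log (n * p) / 4 ≤ Real.log (n * p / (8 * Real.log n))) :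
    comparisonLaw σ T p u {z | ¬ HasUniqueMLENear (normalLink σ) z.1 (Function.curry z.2) u
      (400 * (T * σ ^ 2 + 4) * rate n p)} ≤ ENNReal.ofReal (14 / (n : ℝ) ^ 2) := by
  have hn2 : (2 : ℝ) ≤ n := by exact_mod_cast hn
  have hnp1 : 1 < n * (p : ℝ) := by
    linarith [Real.log_two_gt_d9, Real.log_le_log two_pos hn2]
  set sparse : Set ((Pair n → ℕ) × (Pair n × Fin T → ℝ)) := {z |
    ¬ Expands (comparisonEnds T z.1) (n * p / 20) (n * p / (8 * Real.log n))}
  set noisy : Set ((Pair n → ℕ) × (Pair n × Fin T → ℝ)) := {z |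
    ∃ i, (T * σ ^ 2 + 4) * √(n * p * Real.log n) ≤ |noise u z.1 (Function.curry z.2) i|}
  have hsparse : comparisonLaw σ T p u sparse ≤ ENNReal.ofReal (9 / (n : ℝ) ^ 3) :=
    (measurePreserving_fst.measure_preimage
      (MeasurableSet.of_discrete (s := {k : Pair n → ℕ | ¬ Expands (comparisonEnds T k)
        (n * p / 20) (n * p / (8 * Real.log n))})).nullMeasurableSet).trans_le
      (measure_not_expands_le hT hn hnp)
  have hnoisy : comparisonLaw σ T p u noisy ≤ ENNReal.ofReal (2 / (n : ℝ) ^ 3) :=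
    measure_exists_le_abs_noise_le σ u hn (by linarith) hσp
  refine (measure_mono (t := sparse ∪ noisy) fun z hz => ?_).trans <|
    (measure_union_le _ _).trans <| (add_le_add hsparse hnoisy).trans ?_
  · by_contra hgood
    simp only [sparse, noisy, Set.mem_union, Set.mem_ofPred_eq, not_or, not_not, not_exists,
      not_le] at hgood
    exact hz (hasUniqueMLENear_rate_of_expands hσ (by positivity) hu hnp1 hρ hgood.1
      fun i => (hgood.2 i).le)
  · rw [← ENNReal.ofReal_add (by positivity) (by positivity), ← add_div]
    refine ENNReal.ofReal_le_ofReal ?_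
    gcongr <;> norm_num
    linarith

theorem IsNormalComparison.hasLaw {Ω : Type*} [MeasurableSpace Ω] {P : Measure Ω}
    [IsProbabilityMeasure P] {σ : ℝ} {N : Pair n → Ω → ℕ} {X : Pair n → Fin T → Ω → ℝ}
    (h : IsNormalComparison P σ p u N X) :
    HasLaw (fun ω => (fun e => N e ω, fun a : Pair n × Fin T => X a.1 a.2 ω))
      (comparisonLaw σ T p u) P :=
  h.count_outcome_indep.hasLaw_prod (h.count_indep.hasLaw_pi h.count_law)
    (h.outcome_indep.hasLaw_pi fun a => h.outcome_law a.1 a.2)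

end Nonasymptotic

section Rate

variable {n : ℕ} {p : ℝ}

theorem mul_log_lt_of_rate_lt (hp : p ≤ 1) (hnp : 1 < n * p) {M : ℝ} (hM : 0 < M)
    (hrate : rate n p < √(1 / M)) : M * Real.log n < n * p := by
  have hle : n * p ≤ n := mul_le_of_le_one_right n.cast_nonneg hp
  have hL : 0 < Real.log n := Real.log_pos (hnp.trans_le hle)
  have hratio : 1 ≤ Real.log n / Real.log (n * p) :=
    (one_le_div (Real.log_pos hnp)).2 (Real.log_le_log (by linarith) hle)
  have hsqrt : √(Real.log n / (n * p)) < √(1 / M) :=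
    (le_mul_of_one_le_right (Real.sqrt_nonneg _) hratio).trans_lt hrate
  rw [Real.sqrt_lt_sqrt_iff (by positivity), div_lt_div_iff₀ (by linarith) hM] at hsqrt
  linarith

theorem log_div_four_le_of_rate_lt_one (hp : p ≤ 1) (hnp : 1 < n * p) (hrate : rate n p < 1)
    (hlog : 4 * Real.log 8 ≤ Real.log (n * p))
    (hloglog : Real.log (Real.log (n * p)) ≤ Real.log (n * p) / 4) :
    Real.log (n * p) / 4 ≤ Real.log (n * p / (8 * Real.log n)) := by
  have hle : n * p ≤ n := mul_le_of_le_one_right n.cast_nonneg hp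
  have hL : 0 < Real.log n := Real.log_pos (hnp.trans_le hle)
  have hl : 0 < Real.log (n * p) := Real.log_pos hnp
  have hlt : Real.log (rate n p) < 0 := Real.log_neg (by rw [rate]; positivity) hrate
  rw [rate, Real.log_mul (by positivity) (by positivity), Real.log_sqrt (by positivity),
    Real.log_div hL.ne' (by positivity), Real.log_div hL.ne' hl.ne'] at hlt
  rw [Real.log_div (by positivity) (by positivity), Real.log_mul (by norm_num) hL.ne']
  linarith

variable {p : ℕ → unitInterval}

theorem tendsto_mul_atTop_of_tendsto_rate (hnp : ∀ᶠ n : ℕ in atTop, 1 < n * (p n : ℝ))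
    (hrate : Tendsto (fun n : ℕ => rate n (p n)) atTop (𝓝 0)) :
    Tendsto (fun n : ℕ => n * (p n : ℝ)) atTop atTop := by
  refine tendsto_atTop_mono' _ ?_ (Real.tendsto_log_atTop.comp tendsto_natCast_atTop_atTop)
  filter_upwards [hnp, hrate.eventually_lt_const (u := √(1 / 1)) (by simp)] with n hnp hrate
  simpa only [Function.comp_apply, one_mul] using
    (mul_log_lt_of_rate_lt (p n).2.2 hnp one_pos hrate).le

theorem eventually_log_div_four_le (hnp : ∀ᶠ n : ℕ in atTop, 1 < n * (p n : ℝ))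
    (hrate : Tendsto (fun n : ℕ => rate n (p n)) atTop (𝓝 0)) :
    ∀ᶠ n : ℕ in atTop,
      Real.log (n * p n) / 4 ≤ Real.log (n * p n / (8 * Real.log n)) := by
  have hlog : Tendsto (fun n : ℕ => Real.log (n * (p n : ℝ))) atTop atTop :=
    Real.tendsto_log_atTop.comp (tendsto_mul_atTop_of_tendsto_rate hnp hrate)
  have hloglog : ∀ᶠ z : ℝ in atTop, Real.log z ≤ z / 4 := by
    filter_upwards [Real.isLittleO_log_id_atTop.bound (show (0 : ℝ) < 1 / 4 by norm_num),
      eventually_ge_atTop 0] with z hz hz0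
    rw [id, Real.norm_of_nonneg hz0] at hz
    linarith [Real.le_norm_self (Real.log z)]
  filter_upwards [hnp, hrate.eventually_lt_const one_pos, hlog.eventually_ge_atTop (4 * Real.log 8),
    hlog.eventually hloglog] with n hnp hrate hlog hloglog
  exact log_div_four_le_of_rate_lt_one (p n).2.2 hnp hrate hlog hloglog

theorem eventually_one_lt_mul {c : ℝ} (hc : 0 < c)
    (hp : ∀ᶠ n : ℕ in atTop, c * (Real.log n / n) ≤ (p n : ℝ)) :
    ∀ᶠ n : ℕ in atTop, 1 < n * (p n : ℝ) := by
  have hlog : Tendsto (fun n : ℕ => c * Real.log n) atTop atTop :=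
    (Real.tendsto_log_atTop.comp tendsto_natCast_atTop_atTop).const_mul_atTop hc
  filter_upwards [hp, eventually_gt_atTop 0, hlog.eventually_gt_atTop 1] with n hpn hn hgt
  have hn0 : (0 : ℝ) < n := Nat.cast_pos.2 hn
  calc 1 < c * Real.log n := hgt
    _ = n * (c * (Real.log n / n)) := by rw [mul_left_comm, mul_div_cancel₀ _ hn0.ne']
    _ ≤ n * p n := by gcongr

end Rate

section Consistency

variable {Ω : Type*} [MeasurableSpace Ω] {P : Measure Ω}

theorem ae_eventually_of_eventually_measure_not_le {Q : ℕ → Ω → Prop} {ε : ℕ → ℝ≥0∞}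
    (hQ : ∀ᶠ n in atTop, P {ω | ¬ Q n ω} ≤ ε n) (hε : ∑' n, ε n ≠ ∞) :
    ∀ᵐ ω ∂P, ∀ᶠ n in atTop, Q n ω := by
  obtain ⟨m, hm⟩ := eventually_atTop.1 hQ
  have hsum : ∑' n, P {ω | ¬ Q (n + m) ω} ≠ ∞ :=
    ne_top_of_le_ne_top hε <| (ENNReal.tsum_le_tsum fun n => hm (n + m) le_add_self).trans
      (ENNReal.tsum_comp_le_tsum_of_injective (add_left_injective m) ε)
  filter_upwards [ae_eventually_notMem hsum] with ω hω
  rw [← map_add_atTop_eq_nat m, eventually_map]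
  exact hω.mono fun n hn => not_not.1 hn

variable [IsProbabilityMeasure P] {σ : ℝ} {T : ℕ} {p : ℕ → unitInterval}
  {u : (n : ℕ) → Fin n → ℝ} {N : (n : ℕ) → Pair n → Ω → ℕ}
  {X : (n : ℕ) → Pair n → Fin T → Ω → ℝ}

theorem eventually_measure_not_hasUniqueMLENear_le (hσ : σ ≠ 0) (hT : 1 ≤ T)
    (hu : ∀ n, u n ∈ scoreSpace n)
    (hmodel : ∀ n, IsNormalComparison P σ (p n) (u n) (N n) (X n))
    (hnp : ∀ᶠ n : ℕ in atTop, 1 < n * (p n : ℝ))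
    (hrate : Tendsto (fun n : ℕ => rate n (p n)) atTop (𝓝 0)) :
    ∀ᶠ n : ℕ in atTop,
      P {ω | ¬ HasUniqueMLENear (normalLink σ) (fun e => N n e ω) (fun e t => X n e t ω) (u n)
        (400 * (T * σ ^ 2 + 4) * rate n (p n))} ≤ ENNReal.ofReal (14 / (n : ℝ) ^ 2) := by
  filter_upwards [hnp, hrate.eventually_lt_const (u := √(1 / (32 + σ ^ 2))) (by positivity),
    eventually_log_div_four_le hnp hrate, eventually_ge_atTop 2] with n hnp hrate hρ hn
  have hsparsity := mul_log_lt_of_rate_lt (p n).2.2 hnp (by positivity) hrate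
  have hL : 0 < Real.log n := Real.log_pos (by exact_mod_cast hn)
  have hσL : 0 ≤ σ ^ 2 * Real.log n := by positivity
  have hbound := measure_not_hasUniqueMLENear_le hσ (hu n) hT hn
    (by linarith : 32 * Real.log n ≤ n * p n) (by linarith) hρ
  rw [← (hmodel n).hasLaw.map_eq] at hbound
  exact (Measure.le_map_apply (hmodel n).hasLaw.aemeasurable _).trans hbound

theorem mainTheorem7_general (hσ : σ ≠ 0) (hT : 1 ≤ T) (hu : ∀ n, u n ∈ scoreSpace n)
    (hmodel : ∀ n, IsNormalComparison P σ (p n) (u n) (N n) (X n))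
    (hnp : ∀ᶠ n : ℕ in atTop, 1 < n * (p n : ℝ))
    (hrate : Tendsto (fun n : ℕ => rate n (p n)) atTop (𝓝 0)) :
    (∀ᶠ n : ℕ in atTop,
      P {ω | ¬ HasUniqueMLENear (normalLink σ) (fun e => N n e ω) (fun e t => X n e t ω) (u n)
        (400 * (T * σ ^ 2 + 4) * rate n (p n))} ≤ ENNReal.ofReal (14 / (n : ℝ) ^ 2)) ∧
    ∀ᵐ ω ∂P,
      (∀ᶠ n : ℕ in atTop,
        ∃! v, IsMLE (normalLink σ) (fun e => N n e ω) (fun e t => X n e t ω) v) ∧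
      ∀ w : (n : ℕ) → Fin n → ℝ,
        (∀ᶠ n : ℕ in atTop,
          IsMLE (normalLink σ) (fun e => N n e ω) (fun e t => X n e t ω) (w n)) →
        Tendsto (fun n => ‖w n - u n‖) atTop (𝓝 0) := by
  have hprob := eventually_measure_not_hasUniqueMLENear_le hσ hT hu hmodel hnp hrate
  have hsummable : Summable fun n : ℕ => 14 / (n : ℝ) ^ 2 := by
    simpa only [div_eq_mul_inv] using
      (Real.summable_nat_pow_inv.2 one_lt_two).mul_left (14 : ℝ)
  have hradius : Tendsto (fun n : ℕ => 400 * (T * σ ^ 2 + 4) * rate n (p n)) atTop (𝓝 0) := by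
    simpa only [mul_zero] using hrate.const_mul (400 * (T * σ ^ 2 + 4))
  refine ⟨hprob, ?_⟩
  filter_upwards [ae_eventually_of_eventually_measure_not_le hprob hsummable.tsum_ofReal_ne_top]
    with ω hω
  exact ⟨hω.mono fun n hn => hn.1, fun w hw => squeeze_zero' (.of_forall fun n => norm_nonneg _)
    ((hω.and hw).mono fun n hn => hn.1.2 _ hn.2) hradius⟩

end Consistency

theorem mainTheorem7 (σ : ℝ) (hσ : 0 < σ) (T : ℕ) (hT : 1 ≤ T) :
    ∃ C : ℝ, 0 < C ∧
      ∀ (Ω : Type*) [MeasurableSpace Ω] (P : Measure Ω) [IsProbabilityMeasure P]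
        (p : ℕ → unitInterval) (u : (n : ℕ) → Fin n → ℝ)
        (N : (n : ℕ) → Pair n → Ω → ℕ) (X : (n : ℕ) → Pair n → Fin T → Ω → ℝ),
        (∀ n, u n ∈ scoreSpace n) →
        (∀ n, IsNormalComparison P σ (p n) (u n) (N n) (X n)) →
        -- standing sparsity assumption
        (∃ c : ℝ, 1 < c ∧ ∀ᶠ n : ℕ in atTop, c * (Real.log n / n) ≤ (p n : ℝ)) →
        Tendsto (fun n : ℕ => dynamicRange (u n) * Real.exp (dynamicRange (u n)) *
          (Real.log n / Real.log (n * (p n : ℝ)))) atTop (𝓝 0) →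
        Tendsto (fun n : ℕ => rate n (p n)) atTop (𝓝 0) →
        -- outside an event of (outer) probability at most `14 / n ^ 2`, the estimate exists,
        -- is unique, and is within `C * rate` of the true scores in the sup norm
        (∀ᶠ n : ℕ in atTop,
          P {ω | ¬ ((∃! v, IsMLE (normalLink σ) (fun e => N n e ω) (fun e t => X n e t ω) v) ∧
              ∀ v, IsMLE (normalLink σ) (fun e => N n e ω) (fun e t => X n e t ω) v →
                ‖v - u n‖ ≤ C * rate n (p n))}
            ≤ ENNReal.ofReal (14 / (n : ℝ) ^ 2)) ∧
        -- almost surely, the estimate exists and is unique for all but finitely many `n`,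
        -- and it converges uniformly to the true scores
        (∀ᵐ ω ∂P,
          (∀ᶠ n : ℕ in atTop,
            ∃! v, IsMLE (normalLink σ) (fun e => N n e ω) (fun e t => X n e t ω) v) ∧
          ∀ w : (n : ℕ) → Fin n → ℝ,
            (∀ᶠ n : ℕ in atTop,
              IsMLE (normalLink σ) (fun e => N n e ω) (fun e t => X n e t ω) (w n)) →
            Tendsto (fun n => ‖w n - u n‖) atTop (𝓝 0)) := by
  refine ⟨400 * (T * σ ^ 2 + 4), by positivity, ?_⟩
  intro Ω _ P _ p u N X hu hmodel ⟨c, hc, hp⟩ _ hrate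
  exact mainTheorem7_general hσ.ne' hT hu hmodel (eventually_one_lt_mul (by linarith) hp) hrate
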